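/- Let $\mathbb K$ be $\mathbb R$ or $\mathbb C$, and let $c_0$ be the space of $\mathbb K$-valued null sequences with the supremum norm. There is a separable Fréchet space $E$ over $\mathbb K$, with an increasing sequence $p_1\le p_2\le\dots$ of seminorms defining its topology, such that every local Banach space $E_{p_k}$ (the completion of $E/\ker p_k$ in the norm induced by $p_k$) is isometrically isomorphic to $c_0$, and such that the following holds. Let $B\subset E$ be a non-empty bounded absolutely convex set, with extended Minkowski functional $p_B(x)=\inf\{|c| : c\in\mathbb K,\ x\in cB\}\in[0,\infty]$, and let $E_B$ be the linear span of $B$ with the norm $p_B$. Suppose that (*) there are $1\le\alpha\le\beta\le\infty$ and non-decreasing sequences $(r_k)$, $(s_k)$ of positive numbers with $r_k\le s_k$ for all $k$ and $\sum_k r_k^{-\alpha}\le 1$ (for $\alpha=\infty$: $\sup_k r_k^{-1}\le 1$), such that $p_B$ is formed by the real interpolation method from $$p^{(\alpha)}=\Big(\sum_{k}(r_k^{-1}p_k)^\alpha\Big)^{1/\alpha}\quad\text{and}\quad p^{(\beta)}=\Big(\sum_{k}(s_k^{-1}p_k)^\beta\Big)^{1/\beta}$$ (values in $[0,\infty]$;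 suprema if the exponent is $\infty$). That is, for some $0<\theta<1$ and $1\le q\le\infty$ there are constants $c,C>0$ with $c\,N\le p_B\le C\,N$ on $E$, where $$N(x)=\Big(\int_0^\infty\big(t^{-\theta}K(t,x)\big)^q\,\frac{dt}{t}\Big)^{1/q},\qquad K(t,x)=\inf_{y\in E}\big(p^{(\alpha)}(y)+t\,p^{(\beta)}(x-y)\big),$$ and $N(x)=\sup_{t>0}t^{-\theta}K(t,x)$ if $q=\infty$. Then $E_B$ is not isomorphic (linearly homeomorphic) to $c_0$. In particular this holds for every Banach disc (closed bounded absolutely convex set) $B$ that satisfies (*). -/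

import Mathlib

open scoped ENNReal Pointwise ZeroAtInfty

universe u

noncomputable section

/-- The vector space `F` endowed with the seminorm `p` (a type synonym of `F`). -/
def SeminormSpace {𝕜 F : Type*} [NormedField 𝕜] [AddCommGroup F] [Module 𝕜 F]
    (_p : Seminorm 𝕜 F) : Type _ := F

instance {𝕜 F : Type*} [NormedField 𝕜] [AddCommGroup F] [Module 𝕜 F] (p : Seminorm 𝕜 F) :
    SeminormedAddCommGroup (SeminormSpace p) :=
  p.toSeminormedAddCommGroup

instance {𝕜 F : Type*} [NormedField 𝕜] [AddCommGroup F] [Module 𝕜 F] (p : Seminorm 𝕜 F) :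
    NormedSpace 𝕜 (SeminormSpace p) where
  toModule := inferInstanceAs (Module 𝕜 F)
  norm_smul_le a x := (map_smul_eq_mul p a x).le

/-- The local Banach space `E_p` of a seminorm `p`: the (Hausdorff) completion of `(E, p)`,
i.e. the completion of `E / ker p` with the norm induced by `p`. -/
abbrev LocalBanachSpace {𝕜 F : Type*} [NormedField 𝕜] [AddCommGroup F] [Module 𝕜 F]
    (p : Seminorm 𝕜 F) : Type _ := UniformSpace.Completion (SeminormSpace p)

/-- Non-empty absolutely convex sets (`𝕜`-valued coefficients, in the sense of
`∑ |λᵢ| ≤ 1`; the case of two coefficients implies the case of finitely many). -/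
structure IsAbsConvexSet (𝕜 : Type*) {E : Type*} [NormedField 𝕜] [AddCommGroup E] [Module 𝕜 E]
    (B : Set E) : Prop where
  nonempty : B.Nonempty
  combo_mem : ∀ x ∈ B, ∀ y ∈ B, ∀ a b : 𝕜, ‖a‖ + ‖b‖ ≤ 1 → a • x + b • y ∈ B

section Disc

variable {𝕜 E : Type*} [RCLike 𝕜] [AddCommGroup E] [Module 𝕜 E] {B : Set E}

theorem IsAbsConvexSet.smul_mem (hB : IsAbsConvexSet 𝕜 B) {x : E} (hx : x ∈ B) {a : 𝕜}
    (ha : ‖a‖ ≤ 1) : a • x ∈ B := by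
  have := hB.combo_mem x hx x hx a 0 (by simpa using ha)
  simpa using this

theorem IsAbsConvexSet.egauge_add_le (hB : IsAbsConvexSet 𝕜 B) (x y : E) :
    egauge 𝕜 B (x + y) ≤ egauge 𝕜 B x + egauge 𝕜 B y := by
  have key : ∀ c : 𝕜, x ∈ c • B → ∀ d : 𝕜, y ∈ d • B →
      egauge 𝕜 B (x + y) ≤ ‖c‖ₑ + ‖d‖ₑ := by
    rintro c ⟨u, hu, rfl⟩ d ⟨v, hv, rfl⟩
    have hs : ‖((‖c‖ + ‖d‖ : ℝ) : 𝕜)‖ = ‖c‖ + ‖d‖ := by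
      rw [RCLike.norm_ofReal, abs_of_nonneg (by positivity)]
    have hm : c • u + d • v ∈ ((‖c‖ + ‖d‖ : ℝ) : 𝕜) • B := by
      rcases eq_or_ne (‖c‖ + ‖d‖) 0 with h0 | h0
      · have hc : c = 0 := norm_eq_zero.1 (by nlinarith [norm_nonneg c, norm_nonneg d])
        have hd : d = 0 := norm_eq_zero.1 (by nlinarith [norm_nonneg c, norm_nonneg d])
        exact ⟨u, hu, by simp [hc, hd]⟩
      · have h0' : ((‖c‖ + ‖d‖ : ℝ) : 𝕜) ≠ 0 := by
          intro h
          exact h0 (by exact_mod_cast h)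
        refine ⟨(((‖c‖ + ‖d‖ : ℝ) : 𝕜)⁻¹ * c) • u + (((‖c‖ + ‖d‖ : ℝ) : 𝕜)⁻¹ * d) • v,
          hB.combo_mem u hu v hv _ _ ?_, ?_⟩
        · rw [norm_mul, norm_mul, norm_inv, hs, ← mul_add, inv_mul_cancel₀ h0]
        · simp only [smul_add, smul_smul, mul_inv_cancel_left₀ h0']
    refine (egauge_le_of_mem_smul hm).trans (le_of_eq ?_)
    rw [← ofReal_norm, hs, ENNReal.ofReal_add (norm_nonneg _) (norm_nonneg _), ofReal_norm,
      ofReal_norm]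
  refine ENNReal.le_of_forall_pos_le_add fun ε hε hfin => ?_
  have hx : egauge 𝕜 B x < egauge 𝕜 B x + ε / 2 :=
    ENNReal.lt_add_right (ne_top_of_lt (lt_of_le_of_lt le_self_add hfin)) (by simpa using hε.ne')
  have hy : egauge 𝕜 B y < egauge 𝕜 B y + ε / 2 :=
    ENNReal.lt_add_right (ne_top_of_lt (lt_of_le_of_lt le_add_self hfin)) (by simpa using hε.ne')
  obtain ⟨c, hc, hc'⟩ := egauge_lt_iff.1 hx
  obtain ⟨d, hd, hd'⟩ := egauge_lt_iff.1 hy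
  calc egauge 𝕜 B (x + y) ≤ ‖c‖ₑ + ‖d‖ₑ := key c hc d hd
    _ ≤ (egauge 𝕜 B x + ε / 2) + (egauge 𝕜 B y + ε / 2) := add_le_add hc'.le hd'.le
    _ = egauge 𝕜 B x + egauge 𝕜 B y + ε := by
      rw [add_add_add_comm, ENNReal.add_halves]

theorem IsAbsConvexSet.egauge_ne_top (hB : IsAbsConvexSet 𝕜 B) {x : E}
    (hx : x ∈ Submodule.span 𝕜 B) : egauge 𝕜 B x ≠ ⊤ := by
  induction hx using Submodule.span_induction with
  | mem x hx => exact ne_top_of_le_ne_top ENNReal.one_ne_top (egauge_le_one 𝕜 hx)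
  | zero => simp [egauge_zero_right 𝕜 hB.nonempty]
  | add x y _ _ hx hy =>
    exact ne_top_of_le_ne_top (ENNReal.add_ne_top.2 ⟨hx, hy⟩) (hB.egauge_add_le x y)
  | smul a x _ hx =>
    rw [egauge_smul_right (fun _ => hB.nonempty)]
    exact ENNReal.mul_ne_top enorm_ne_top hx

/-- The Minkowski functional `p_B` of an absolutely convex set `B`, on the linear span of `B`. -/
def discSeminorm (hB : IsAbsConvexSet 𝕜 B) : Seminorm 𝕜 (Submodule.span 𝕜 B) :=
  Seminorm.of (fun x => (egauge 𝕜 B (x : E)).toReal)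
    (fun x y => by
      rw [← ENNReal.toReal_add (hB.egauge_ne_top x.2) (hB.egauge_ne_top y.2)]
      exact ENNReal.toReal_mono
        (ENNReal.add_ne_top.2 ⟨hB.egauge_ne_top x.2, hB.egauge_ne_top y.2⟩)
        (hB.egauge_add_le x y))
    (fun a x => by
      simp [egauge_smul_right (fun _ : a = 0 => hB.nonempty)])

/-- The space `E_B`: the linear span of `B` with the Minkowski functional of `B` as norm. -/
abbrev DiscSpace (hB : IsAbsConvexSet 𝕜 B) : Type _ := SeminormSpace (discSeminorm hB)

end Disc

/-- The `ℓ_α`-norm of a sequence in `[0, ∞]`, possibly infinite; the supremum for `α = ∞`. -/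
def extLpNorm (α : ℝ≥0∞) (x : ℕ → ℝ≥0∞) : ℝ≥0∞ :=
  if α = ∞ then ⨆ k, x k else (∑' k, x k ^ α.toReal) ^ (1 / α.toReal)

/-- The extended norm `(∑ₖ (rₖ⁻¹ pₖ(x))^α)^(1/α)`; the Banach space `E_α` is the set of points
where it is finite. -/
def weightedSumNorm {𝕜 E : Type*} [NormedField 𝕜] [AddCommGroup E] [Module 𝕜 E]
    (p : ℕ → Seminorm 𝕜 E) (α : ℝ≥0∞) (r : ℕ → ℝ) (x : E) : ℝ≥0∞ :=
  extLpNorm α fun k => ENNReal.ofReal ((r k)⁻¹ * p k x)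

/-- Peetre's functional `K(t, x) = inf {N₀(y) + t N₁(z) : x = y + z}` of two extended norms; only
`y` and `z` in the spaces where `N₀`, resp. `N₁`, is finite contribute. -/
def peetreK {E : Type*} [AddCommGroup E] (N₀ N₁ : E → ℝ≥0∞) (t : ℝ) (x : E) : ℝ≥0∞ :=
  ⨅ y : E, N₀ y + ENNReal.ofReal t * N₁ (x - y)

/-- The norm of the real interpolation space `(E₀, E₁)_{θ, q}` (`K`-method),
`(∫₀^∞ (t^(-θ) K(t, x))^q dt/t)^(1/q)`, resp. `sup_{t > 0} t^(-θ) K(t, x)` for `q = ∞`. The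
interpolation space is the set of points where it is finite. -/
def realInterpNorm {E : Type*} [AddCommGroup E] (N₀ N₁ : E → ℝ≥0∞) (θ : ℝ) (q : ℝ≥0∞)
    (x : E) : ℝ≥0∞ :=
  if q = ∞ then ⨆ t : ℝ, ⨆ _ : 0 < t, ENNReal.ofReal (t ^ (-θ)) * peetreK N₀ N₁ t x
  else (∫⁻ t in Set.Ioi (0 : ℝ),
    (ENNReal.ofReal (t ^ (-θ)) * peetreK N₀ N₁ t x) ^ q.toReal * ENNReal.ofReal t⁻¹) ^
      (1 / q.toReal)

/-- The Minkowski functional of `B` is, up to equivalence, the norm obtained from `N₀` and `N₁` by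
the real interpolation method, for some parameters `0 < θ < 1` and `1 ≤ q ≤ ∞`. In particular
the span of `B` is the interpolation space. -/
def FormedByRealInterpolation (𝕜 : Type*) {E : Type*} [NormedField 𝕜] [AddCommGroup E]
    [Module 𝕜 E] (B : Set E) (N₀ N₁ : E → ℝ≥0∞) : Prop :=
  ∃ (θ : ℝ) (q : ℝ≥0∞) (c C : ℝ), 0 < θ ∧ θ < 1 ∧ 1 ≤ q ∧ 0 < c ∧ 0 < C ∧
    ∀ x : E, ENNReal.ofReal c * realInterpNorm N₀ N₁ θ q x ≤ egauge 𝕜 B x ∧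
      egauge 𝕜 B x ≤ ENNReal.ofReal C * realInterpNorm N₀ N₁ θ q x

/-- Condition `(*)` on a set `B` in a space with the seminorms `p`. The requirement
`∑ₖ rₖ^(-α) ≤ 1` is written as: the `ℓ_α`-norm of `(rₖ⁻¹)` is at most `1`, which for `α = ∞`
means `sup rₖ⁻¹ ≤ 1`. -/
def ConditionStar {𝕜 E : Type*} [NormedField 𝕜] [AddCommGroup E] [Module 𝕜 E]
    (p : ℕ → Seminorm 𝕜 E) (B : Set E) : Prop :=
  ∃ (α β : ℝ≥0∞) (r s : ℕ → ℝ), 1 ≤ α ∧ α ≤ β ∧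
    (∀ k, 0 < r k) ∧ (∀ k, 0 < s k) ∧ Monotone r ∧ Monotone s ∧ (∀ k, r k ≤ s k) ∧
    extLpNorm α (fun k => ENNReal.ofReal (r k)⁻¹) ≤ 1 ∧
    FormedByRealInterpolation 𝕜 B (weightedSumNorm p α r) (weightedSumNorm p β s)

end

/-! `E` is the space of rapidly decreasing sequences. Each seminorm is a weighted sup norm, so its
local Banach space is c₀. Yet any scalar sequence whose weighted sup norms are all finite lies in
`E` (`mem_range_rapidCoord`), and the balls of p^(α) are compact for coordinatewise convergence
(`isCompact_rapidWeighted_le`). Hence K(t, ·) is lower semicontinuous for that convergence, and by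
Fatou's lemma so is the interpolation norm (`realInterpNorm_le_of_tendsto`). Up to a constant,
bounds on p_B therefore survive coordinatewise limits (`egauge_rapid_le_of_tendsto`).

This is incompatible with an isomorphism T from E_B to c₀. Since B is bounded, T⁻¹ is a bounded
operator from c₀ to `E`; coordinatewise limits along truncations extend it to ℓ_∞
(`exists_extension_to_bounded`). By semicontinuity the extension maps boundedly into E_B. Following
it by T gives a bounded operator from ℓ_∞ to c₀ that fixes the unit vectors, which Phillips' lemma
(`not_forall_apply_unit_eq`) excludes. -/

noncomputable section

open Filter Topology BoundedContinuousFunction MeasureTheory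

/-! ### The space c₀ -/

section NullSequences

variable {𝕜 : Type*} [RCLike 𝕜]

theorem exists_norm_le_one_mul_eq_norm (z : 𝕜) : ∃ ε : 𝕜, ‖ε‖ ≤ 1 ∧ ε * z = (‖z‖ : 𝕜) := by
  rcases eq_or_ne z 0 with rfl | hz
  · exact ⟨0, by simp, by simp⟩
  · exact ⟨(‖z‖ : 𝕜) / z, by simp [hz], by field_simp⟩

/-- The element of `c₀` given by a null sequence. -/
def nullSeq (x : ℕ → 𝕜) (hx : Tendsto x atTop (𝓝 0)) : C₀(ℕ, 𝕜) where
  toFun := x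
  continuous_toFun := continuous_of_discreteTopology
  zero_at_infty' := by rwa [cocompact_eq_cofinite, Nat.cofinite_eq_atTop]

@[simp] theorem nullSeq_apply (x : ℕ → 𝕜) (hx : Tendsto x atTop (𝓝 0)) (n : ℕ) :
    nullSeq x hx n = x n := rfl

theorem c0_tendsto_zero (f : C₀(ℕ, 𝕜)) : Tendsto f atTop (𝓝 0) := by
  have := f.zero_at_infty'
  rwa [cocompact_eq_cofinite, Nat.cofinite_eq_atTop] at this

theorem c0_norm_apply_le (f : C₀(ℕ, 𝕜)) (n : ℕ) : ‖f n‖ ≤ ‖f‖ :=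
  f.toBCF.norm_coe_le_norm n

theorem c0_norm_le {f : C₀(ℕ, 𝕜)} {C : ℝ} (hC : 0 ≤ C) (h : ∀ n, ‖f n‖ ≤ C) : ‖f‖ ≤ C :=
  (BoundedContinuousFunction.norm_le (f := f.toBCF) hC).2 h

theorem c0_enorm_eq_iSup (f : C₀(ℕ, 𝕜)) : ‖f‖ₑ = ⨆ n, ‖f n‖ₑ :=
  f.toBCF.enorm_eq_iSup_enorm

variable (𝕜) in
/-- The `n`-th coordinate functional on `c₀`. -/
def c0Eval (n : ℕ) : C₀(ℕ, 𝕜) →L[𝕜] 𝕜 :=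
  LinearMap.mkContinuous
    { toFun := fun f => f n
      map_add' := fun _ _ => rfl
      map_smul' := fun _ _ => rfl } 1 fun f => by simpa using c0_norm_apply_le f n

@[simp] theorem c0Eval_apply (n : ℕ) (f : C₀(ℕ, 𝕜)) : c0Eval 𝕜 n f = f n := rfl

variable (𝕜) in
/-- The unit vectors of `c₀`. -/
def c0Unit (n : ℕ) : C₀(ℕ, 𝕜) :=
  nullSeq (Pi.single n 1) (tendsto_const_nhds.congr' (by
    filter_upwards [eventually_gt_atTop n] with m hm
    simp [Pi.single_eq_of_ne hm.ne']))

theorem c0Unit_apply (n m : ℕ) : c0Unit 𝕜 n m = if m = n then 1 else 0 := by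
  simp [c0Unit, Pi.single_apply]

@[simp] theorem c0_sum_apply {ι : Type*} (s : Finset ι) (f : ι → C₀(ℕ, 𝕜)) (n : ℕ) :
    (∑ i ∈ s, f i) n = ∑ i ∈ s, f i n :=
  map_sum (c0Eval 𝕜 n) f s

theorem c0_sum_unit_apply (a : ℕ → 𝕜) (N m : ℕ) :
    (∑ i ∈ Finset.range N, a i • c0Unit 𝕜 i) m = if m < N then a m else 0 := by
  simp [c0Unit_apply]

theorem c0_dense_span_unit : Dense (Submodule.span 𝕜 (Set.range (c0Unit 𝕜)) : Set C₀(ℕ, 𝕜)) := by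
  rw [Metric.dense_iff]
  intro f ε hε
  obtain ⟨N, hN⟩ := Metric.tendsto_atTop.1 (c0_tendsto_zero f) (ε / 2) (by positivity)
  refine ⟨∑ i ∈ Finset.range N, f i • c0Unit 𝕜 i, ?_, Submodule.sum_mem _ fun i _ =>
    Submodule.smul_mem _ _ (Submodule.subset_span ⟨i, rfl⟩)⟩
  rw [Metric.mem_ball, dist_eq_norm]
  refine (c0_norm_le (C := ε / 2) (by positivity) fun n => ?_).trans_lt (by linarith)
  rw [ZeroAtInftyContinuousMap.sub_apply, c0_sum_unit_apply]
  split_ifs with h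
  · simp; positivity
  · simpa using (hN n (not_lt.1 h)).le

/-- Second countability passes to countable products and to subspaces, which yields the separability
of `rapidSeq`. -/
instance : SecondCountableTopology C₀(ℕ, 𝕜) := by
  have h : TopologicalSpace.IsSeparable (Set.univ : Set C₀(ℕ, 𝕜)) := by
    rw [← (c0_dense_span_unit (𝕜 := 𝕜)).closure_eq]
    exact ((Set.countable_range _).isSeparable.span (R := 𝕜)).closure
  have := TopologicalSpace.isSeparable_univ_iff.1 h
  exact UniformSpace.secondCountable_of_separable _

end NullSequences

/-! ### An uncountable almost disjoint family of subsets of ℕ -/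

section AlmostDisjoint

/-- The set of codes of the initial segments of a `0`-`1`-sequence. -/
def prefixCodes (x : ℕ → Bool) : Set ℕ :=
  Set.range fun m => Encodable.encode (List.ofFn fun i : Fin m => x i)

theorem prefixCodes_infinite (x : ℕ → Bool) : (prefixCodes x).Infinite := by
  refine Set.infinite_range_of_injective fun m m' h => ?_
  have := congrArg List.length (Encodable.encode_injective h)
  simpa using this

/-- A common code determines the length and the entries of the segment, so the length cannot exceed
an index `i` where the sequences differ. -/
theorem prefixCodes_inter_finite {x y : ℕ → Bool} (hxy : x ≠ y) :
    (prefixCodes x ∩ prefixCodes y).Finite := by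
  obtain ⟨i, hi⟩ := Function.ne_iff.1 hxy
  refine ((Finset.range (i + 1)).finite_toSet.image
    fun m => Encodable.encode (List.ofFn fun i : Fin m => x i)).subset ?_
  rintro _ ⟨⟨m, rfl⟩, ⟨m', h⟩⟩
  refine ⟨m, ?_, rfl⟩
  have h' := Encodable.encode_injective h
  have hm : m' = m := by simpa using congrArg List.length h'
  subst hm
  by_contra hc
  have hlt : i < m' := by simp at hc; omega
  exact hi (congrFun (List.ofFn_injective h') ⟨i, hlt⟩).symm

end AlmostDisjoint

/-! ### Phillips' lemma -/

section Phillips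

variable {𝕜 : Type*} [RCLike 𝕜]

variable (𝕜) in
open Classical in
/-- The indicator function of a set of natural numbers as a bounded sequence. -/
def boundedInd (A : Set ℕ) : ℕ →ᵇ 𝕜 :=
  BoundedContinuousFunction.ofNormedAddCommGroupDiscrete (fun n => if n ∈ A then 1 else 0) 1
    fun n => by split_ifs <;> simp

open Classical in
theorem boundedInd_apply (A : Set ℕ) (n : ℕ) :
    boundedInd 𝕜 A n = if n ∈ A then 1 else 0 := rfl

theorem eq_zero_of_finite_support {q : (ℕ →ᵇ 𝕜) →L[𝕜] 𝕜} (hq : ∀ n, q (c0Unit 𝕜 n).toBCF = 0)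
    {f : ℕ →ᵇ 𝕜} {L : ℕ} (hf : ∀ n, L ≤ n → f n = 0) : q f = 0 := by
  have : f = ∑ i ∈ Finset.range L, f i • (c0Unit 𝕜 i).toBCF := by
    ext n
    simp only [BoundedContinuousFunction.coe_sum, Finset.sum_apply,
      BoundedContinuousFunction.coe_smul, ZeroAtInftyContinuousMap.toBCF_apply]
    have := c0_sum_unit_apply (𝕜 := 𝕜) f L n
    simp only [c0_sum_apply, ZeroAtInftyContinuousMap.smul_apply] at this
    rw [this]
    split_ifs with h
    · rfl
    · exact hf n (not_lt.1 h)
  rw [this, map_sum]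
  exact Finset.sum_eq_zero fun i _ => by rw [map_smul, hq, smul_zero]

/-- Choose phases making all values of `q` non-negative and add the indicators. Beyond some `L` the
finitely many sets are disjoint, so the combination is bounded by 1 there; the part up to `L` is
annihilated by `q`. -/
theorem sum_norm_almostDisjoint_le {q : (ℕ →ᵇ 𝕜) →L[𝕜] 𝕜}
    (hq : ∀ n, q (c0Unit 𝕜 n).toBCF = 0) (s : Finset (ℕ → Bool)) :
    ∑ x ∈ s, ‖q (boundedInd 𝕜 (prefixCodes x))‖ ≤ ‖q‖ := by
  classical
  choose ε hε1 hε using exists_norm_le_one_mul_eq_norm (𝕜 := 𝕜)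
  set e : (ℕ → Bool) → 𝕜 := fun x => ε (q (boundedInd 𝕜 (prefixCodes x)))
  set f : ℕ →ᵇ 𝕜 := ∑ x ∈ s, e x • boundedInd 𝕜 (prefixCodes x) with hf
  have hfin : (⋃ x ∈ s, ⋃ y ∈ s, ⋃ _ : x ≠ y, prefixCodes x ∩ prefixCodes y).Finite :=
    s.finite_toSet.biUnion fun x _ => s.finite_toSet.biUnion fun y _ =>
      Set.finite_iUnion fun h => prefixCodes_inter_finite h
  obtain ⟨L, hL⟩ := hfin.bddAbove
  have hfapp : ∀ n, f n = ∑ x ∈ s, e x * (if n ∈ prefixCodes x then 1 else 0) := fun n => by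
    simp [hf, BoundedContinuousFunction.coe_sum, boundedInd_apply]
  have hbound : ∀ n, L < n → ‖f n‖ ≤ 1 := fun n hn => by
    rw [hfapp]
    by_cases h : ∃ x ∈ s, n ∈ prefixCodes x
    · obtain ⟨x, hx, hnx⟩ := h
      rw [Finset.sum_eq_single_of_mem x hx]
      · simpa [hnx] using hε1 _
      · intro y hy hyx
        have : n ∉ prefixCodes y := fun hny => by
          refine hn.not_ge (hL ?_)
          simp only [Set.mem_iUnion]
          exact ⟨y, hy, x, hx, hyx, hny, hnx⟩
        simp [this]
    · push Not at h
      rw [Finset.sum_eq_zero fun x hx => by simp [h x hx]]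
      simp
  set g : ℕ →ᵇ 𝕜 := BoundedContinuousFunction.ofNormedAddCommGroupDiscrete
    (fun n => if L < n then f n else 0) 1
    (fun n => by split_ifs with h; exacts [hbound n h, by simp]) with hg
  have hg1 : ‖g‖ ≤ 1 := BoundedContinuousFunction.norm_ofNormedAddCommGroup_le _ zero_le_one _
  have hfg : q (f - g) = 0 := eq_zero_of_finite_support hq (L := L + 1) fun n hn => by
    have : L < n := hn
    simp [hg, this]
  have hqf : q f = ((∑ x ∈ s, ‖q (boundedInd 𝕜 (prefixCodes x))‖ : ℝ) : 𝕜) := by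
    rw [hf, map_sum, RCLike.ofReal_sum]
    exact Finset.sum_congr rfl fun x _ => by rw [map_smul, smul_eq_mul, hε]
  have hnn : 0 ≤ ∑ x ∈ s, ‖q (boundedInd 𝕜 (prefixCodes x))‖ :=
    Finset.sum_nonneg fun _ _ => norm_nonneg _
  calc ∑ x ∈ s, ‖q (boundedInd 𝕜 (prefixCodes x))‖ = ‖q f‖ := by
        rw [hqf, RCLike.norm_ofReal, abs_of_nonneg hnn]
    _ = ‖q g‖ := by rw [← sub_eq_zero.1 ((map_sub q f g).symm.trans hfg)]
    _ ≤ ‖q‖ * ‖g‖ := q.le_opNorm g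
    _ ≤ ‖q‖ := mul_le_of_le_one_right (norm_nonneg _) hg1

/-- By the preceding bound, at most ‖q‖ (l + 1) indices carry a value of modulus at least 1 / (l +
1). -/
theorem countable_setOf_ne_zero {q : (ℕ →ᵇ 𝕜) →L[𝕜] 𝕜}
    (hq : ∀ n, q (c0Unit 𝕜 n).toBCF = 0) :
    {x : ℕ → Bool | q (boundedInd 𝕜 (prefixCodes x)) ≠ 0}.Countable := by
  have hsub : {x : ℕ → Bool | q (boundedInd 𝕜 (prefixCodes x)) ≠ 0} ⊆
      ⋃ l : ℕ, {x | 1 / ((l : ℝ) + 1) ≤ ‖q (boundedInd 𝕜 (prefixCodes x))‖} := fun x hx => by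
    obtain ⟨l, hl⟩ := exists_nat_one_div_lt (norm_pos_iff.2 hx)
    exact Set.mem_iUnion.2 ⟨l, hl.le⟩
  refine (Set.countable_iUnion fun l => Set.Finite.countable ?_).mono hsub
  by_contra hinf
  obtain ⟨N, hN⟩ := exists_nat_gt (‖q‖ * (l + 1))
  obtain ⟨s, hs, hcard⟩ := Set.Infinite.exists_subset_card_eq hinf N
  have h1 := Finset.card_nsmul_le_sum s (fun x => ‖q (boundedInd 𝕜 (prefixCodes x))‖) _
    fun x hx => hs hx
  have h2 := h1.trans (sum_norm_almostDisjoint_le hq s)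
  rw [hcard, nsmul_eq_mul, mul_one_div, div_le_iff₀ (by positivity)] at h2
  linarith

/-- Phillips' lemma: there is no bounded projection of `ℓ_∞` onto `c₀`. -/
theorem not_forall_apply_unit_eq (V : (ℕ →ᵇ 𝕜) →L[𝕜] C₀(ℕ, 𝕜)) :
    ¬ ∀ n, V (c0Unit 𝕜 n).toBCF = c0Unit 𝕜 n := by
  intro hV
  let q : ℕ → (ℕ →ᵇ 𝕜) →L[𝕜] 𝕜 := fun m =>
    BoundedContinuousFunction.evalCLM 𝕜 m - (c0Eval 𝕜 m).comp V
  have hqapp : ∀ m f, q m f = f m - V f m := fun m f => by simp [q]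
  have hq : ∀ m n, q m (c0Unit 𝕜 n).toBCF = 0 := fun m n => by
    rw [hqapp, hV]; exact sub_self _
  have hcount := Set.countable_iUnion fun m => countable_setOf_ne_zero (hq m)
  -- If every `q m` vanished at the indicator of an infinite set, `V` would fix this indicator,
  -- which is not a null sequence.
  have huniv : (⋃ m, {x : ℕ → Bool | q m (boundedInd 𝕜 (prefixCodes x)) ≠ 0}) = Set.univ := by
    refine Set.eq_univ_of_forall fun x => ?_
    by_contra hx
    simp only [Set.mem_iUnion, Set.mem_ofPred_eq, not_exists, not_not, hqapp, sub_eq_zero] at hx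
    have ht := c0_tendsto_zero (V (boundedInd 𝕜 (prefixCodes x)))
    obtain ⟨N, hN⟩ := Metric.tendsto_atTop.1 ht 1 one_pos
    obtain ⟨n, hn, hNn⟩ := (prefixCodes_infinite x).exists_gt N
    have := hN n hNn.le
    rw [← hx n, boundedInd_apply, if_pos hn] at this
    simp at this
  rw [huniv, Set.countable_univ_iff] at hcount
  -- Cantor's diagonal argument.
  obtain ⟨φ, hφ⟩ := exists_surjective_nat (ℕ → Bool)
  obtain ⟨n, hn⟩ := hφ fun n => !φ n n
  simpa using congrFun hn n

end Phillips

/-! ### Lower semicontinuity of interpolation norms -/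

section Interpolation

theorem lowerSemicontinuous_extLpNorm {X : Type*} [TopologicalSpace X] (α : ℝ≥0∞)
    {f : ℕ → X → ℝ≥0∞} (hf : ∀ k, LowerSemicontinuous (f k)) :
    LowerSemicontinuous fun x => extLpNorm α fun k => f k x := by
  unfold extLpNorm
  split_ifs with h
  · exact lowerSemicontinuous_iSup hf
  · refine ENNReal.continuous_rpow_const.comp_lowerSemicontinuous
      (lowerSemicontinuous_tsum fun k => ?_) (ENNReal.monotone_rpow_of_nonneg (by positivity))
    exact ENNReal.continuous_rpow_const.comp_lowerSemicontinuous (hf k)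
      (ENNReal.monotone_rpow_of_nonneg ENNReal.toReal_nonneg)

theorem le_extLpNorm {α : ℝ≥0∞} (hα : 1 ≤ α) (x : ℕ → ℝ≥0∞) (k : ℕ) : x k ≤ extLpNorm α x := by
  unfold extLpNorm
  split_ifs with h
  · exact le_iSup x k
  · have h0 : 0 < α.toReal := ENNReal.toReal_pos (by rintro rfl; simp at hα) h
    rw [one_div, ENNReal.le_rpow_inv_iff h0]
    exact ENNReal.le_tsum (f := fun k => x k ^ α.toReal) k

/-- Projection along a compact factor is a closed map. -/
theorem isClosed_setOf_exists_le {X Y : Type*} [TopologicalSpace X] [TopologicalSpace Y]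
    {K : Set Y} (hK : IsCompact K) {F : X × Y → ℝ≥0∞} (hF : LowerSemicontinuous F) (L : ℝ≥0∞) :
    IsClosed {x | ∃ y ∈ K, F (x, y) ≤ L} := by
  have := isCompact_iff_compactSpace.1 hK
  have hcl : IsClosed {z : X × K | F (z.1, z.2) ≤ L} :=
    (hF.isClosed_preimage L).preimage (f := fun z : X × K => (z.1, (z.2 : Y))) (by fun_prop)
  convert isClosedMap_fst_of_compactSpace _ hcl using 1
  ext x
  simp

theorem lowerSemicontinuous_peetreK {X : Type*} [AddCommGroup X] [TopologicalSpace X]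
    [IsTopologicalAddGroup X] {N₀ N₁ : X → ℝ≥0∞} (h₀ : LowerSemicontinuous N₀)
    (h₁ : LowerSemicontinuous N₁) (hK : ∀ L, L ≠ ∞ → IsCompact {x | N₀ x ≤ L}) (t : ℝ) :
    LowerSemicontinuous (peetreK N₀ N₁ t) := by
  rw [lowerSemicontinuous_iff_isClosed_preimage]
  intro L
  have hF : LowerSemicontinuous fun z : X × X => N₀ z.2 + ENNReal.ofReal t * N₁ (z.1 - z.2) := by
    refine (h₀.comp continuous_snd).add ?_
    exact (ENNReal.continuous_const_mul ENNReal.ofReal_ne_top).comp_lowerSemicontinuous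
      (h₁.comp (continuous_fst.sub continuous_snd)) fun a b h => by dsimp only; gcongr
  -- Taking `M > L` avoids asking that the infimum be attained. Restricting `y` to the compact set
  -- where `N₀ y ≤ M` loses nothing, as `N₀ y` is at most the whole sum.
  have : peetreK N₀ N₁ t ⁻¹' Set.Iic L = ⋂ M, ⋂ _ : L < M, ⋂ _ : M ≠ ∞,
      {x | ∃ y ∈ {y | N₀ y ≤ M}, N₀ y + ENNReal.ofReal t * N₁ (x - y) ≤ M} := by
    ext x
    simp only [Set.mem_preimage, Set.mem_Iic, Set.mem_iInter]
    constructor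
    · intro h M hM _
      obtain ⟨y, hy⟩ := iInf_lt_iff.1 (lt_of_le_of_lt h hM)
      exact ⟨y, le_self_add.trans hy.le, hy.le⟩
    · intro h
      refine le_of_forall_gt_imp_ge_of_dense fun M hM => ?_
      rcases eq_or_ne M ∞ with rfl | hM'
      · exact le_top
      · obtain ⟨y, -, hy⟩ := h M hM hM'
        exact (iInf_le _ y).trans hy
  rw [this]
  exact isClosed_iInter fun M => isClosed_iInter fun _ => isClosed_iInter fun hM =>
    isClosed_setOf_exists_le (hK M hM) hF M

/-- Supplies the measurability in `t` needed for Fatou's lemma. -/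
theorem peetreK_mono {X : Type*} [AddCommGroup X] (N₀ N₁ : X → ℝ≥0∞) (x : X) :
    Monotone fun t => peetreK N₀ N₁ t x := fun s t h =>
  iInf_mono fun y => by gcongr

theorem realInterpNorm_le_of_tendsto {X : Type*} [AddCommGroup X] [TopologicalSpace X]
    {N₀ N₁ : X → ℝ≥0∞} (hK : ∀ t, LowerSemicontinuous (peetreK N₀ N₁ t)) {θ : ℝ} {q : ℝ≥0∞}
    (hq : 1 ≤ q) {u : ℕ → X} {x : X} (hu : Tendsto u atTop (𝓝 x)) {M : ℝ≥0∞}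
    (hM : ∀ n, realInterpNorm N₀ N₁ θ q (u n) ≤ M) : realInterpNorm N₀ N₁ θ q x ≤ M := by
  have hlim : ∀ t, ENNReal.ofReal (t ^ (-θ)) * peetreK N₀ N₁ t x ≤
      liminf (fun n => ENNReal.ofReal (t ^ (-θ)) * peetreK N₀ N₁ t (u n)) atTop := fun t => by
    have hl : LowerSemicontinuous fun z => ENNReal.ofReal (t ^ (-θ)) * peetreK N₀ N₁ t z :=
      (ENNReal.continuous_const_mul ENNReal.ofReal_ne_top).comp_lowerSemicontinuous
        (hK t) fun a b h => by dsimp only; gcongr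
    exact (hl.le_liminf x).trans (liminf_le_liminf_of_le hu)
  unfold realInterpNorm at hM ⊢
  split_ifs at hM ⊢ with h
  · refine iSup₂_le fun t ht => (hlim t).trans ?_
    refine liminf_le_of_le (by isBoundedDefault) fun b hb => ?_
    obtain ⟨n, hn⟩ := hb.exists
    exact hn.trans ((le_iSup₂ (f := fun (t : ℝ) (_ : 0 < t) =>
      ENNReal.ofReal (t ^ (-θ)) * peetreK N₀ N₁ t (u n)) t ht).trans (hM n))
  · have h0 : 0 < q.toReal := ENNReal.toReal_pos (by rintro rfl; simp at hq) h
    simp only [one_div, ENNReal.rpow_inv_le_iff h0] at hM ⊢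
    have hmeas : ∀ n, Measurable fun t : ℝ =>
        (ENNReal.ofReal (t ^ (-θ)) * peetreK N₀ N₁ t (u n)) ^ q.toReal * ENNReal.ofReal t⁻¹ :=
      fun n => by
        have := (peetreK_mono N₀ N₁ (u n)).measurable
        fun_prop
    calc _ ≤ ∫⁻ t in Set.Ioi (0 : ℝ), liminf (fun n =>
          (ENNReal.ofReal (t ^ (-θ)) * peetreK N₀ N₁ t (u n)) ^ q.toReal * ENNReal.ofReal t⁻¹)
          atTop := lintegral_mono fun t => by
          have hm : Monotone fun a : ℝ≥0∞ => a ^ q.toReal * ENNReal.ofReal t⁻¹ :=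
            fun a b hab => by dsimp only; gcongr
          have hc : Continuous fun a : ℝ≥0∞ => a ^ q.toReal * ENNReal.ofReal t⁻¹ :=
            (ENNReal.continuous_mul_const ENNReal.ofReal_ne_top).comp
              ENNReal.continuous_rpow_const
          exact (hm (hlim t)).trans (hm.map_liminf_of_continuousAt _ hc.continuousAt).le
      _ ≤ liminf (fun n => ∫⁻ t in Set.Ioi (0 : ℝ),
          (ENNReal.ofReal (t ^ (-θ)) * peetreK N₀ N₁ t (u n)) ^ q.toReal *
            ENNReal.ofReal t⁻¹) atTop := lintegral_liminf_le hmeas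
      _ ≤ M ^ q.toReal := by
          refine liminf_le_of_le (by isBoundedDefault) fun b hb => ?_
          obtain ⟨n, hn⟩ := hb.exists
          exact hn.trans (hM n)

end Interpolation

/-! ### Identification of local Banach spaces -/

theorem nonempty_localBanachSpace_equiv {𝕜 F G : Type*} [NormedField 𝕜] [AddCommGroup F]
    [Module 𝕜 F] [NormedAddCommGroup G] [NormedSpace 𝕜 G] [CompleteSpace G] (p : Seminorm 𝕜 F)
    (j : F →ₗ[𝕜] G) (hj : ∀ x, ‖j x‖ = p x) (hd : DenseRange j) :
    Nonempty (LocalBanachSpace p ≃ₗᵢ[𝕜] G) := by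
  let j' : SeminormSpace p →ₗᵢ[𝕜] G := { toLinearMap := j, norm_map' := hj }
  let e : SeminormSpace p →L[𝕜] LocalBanachSpace p := UniformSpace.Completion.toComplL
  let J : LocalBanachSpace p →L[𝕜] G := j'.toContinuousLinearMap.extend e
  have hJ : ∀ x : SeminormSpace p, J x = j x := fun x =>
    ContinuousLinearMap.extend_eq (e := e) _ UniformSpace.Completion.denseRange_coe
      (UniformSpace.Completion.isUniformInducing_coe _) x
  have hnorm : ∀ x, ‖J x‖ = ‖x‖ := fun x => by
    induction x using UniformSpace.Completion.induction_on with
    | hp => exact isClosed_eq (by fun_prop) (by fun_prop)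
    | ih a => rw [hJ, UniformSpace.Completion.norm_coe]; exact hj a
  let J' : LocalBanachSpace p →ₗᵢ[𝕜] G := { toLinearMap := J.toLinearMap, norm_map' := hnorm }
  have hdense : DenseRange J' := hd.mono (by rintro _ ⟨x, rfl⟩; exact ⟨_, hJ x⟩)
  have hsurj : Function.Surjective J' := by
    rw [← Set.range_eq_univ, ← J'.isometry.isClosedEmbedding.isClosed_range.closure_eq]
    exact hdense.closure_range
  exact ⟨LinearIsometryEquiv.ofSurjective J' hsurj⟩

/-! ### The Fréchet space of rapidly decreasing sequences -/

section RapidlyDecreasing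

variable (𝕜 : Type*) [RCLike 𝕜]

/-- The Köthe space of rapidly decreasing sequences `x`: the families in `c₀` of the form
`((n + 1) ^ k * x n)ₙ`, `k ∈ ℕ`. -/
def rapidSeq : Submodule 𝕜 (ℕ → C₀(ℕ, 𝕜)) where
  carrier := {f | ∀ k n, f k n = ((n : 𝕜) + 1) ^ k * f 0 n}
  add_mem' {f g} hf hg k n := by
    simp only [Pi.add_apply, ZeroAtInftyContinuousMap.add_apply, hf k n, hg k n, mul_add]
  zero_mem' k n := by simp
  smul_mem' a f hf k n := by
    simp only [Pi.smul_apply, ZeroAtInftyContinuousMap.smul_apply, hf k n, smul_eq_mul]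
    ring

theorem isClosed_rapidSeq : IsClosed (rapidSeq 𝕜 : Set (ℕ → C₀(ℕ, 𝕜))) := by
  have : (rapidSeq 𝕜 : Set (ℕ → C₀(ℕ, 𝕜))) =
      ⋂ k, ⋂ n, {f | c0Eval 𝕜 n (f k) = ((n : 𝕜) + 1) ^ k * c0Eval 𝕜 n (f 0)} := by
    ext f
    simp only [Set.mem_iInter, c0Eval_apply]
    exact Iff.rfl
  rw [this]
  exact isClosed_iInter fun k => isClosed_iInter fun n => isClosed_eq (by fun_prop) (by fun_prop)

instance : SecondCountableTopology (rapidSeq 𝕜) :=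
  Topology.IsEmbedding.subtypeVal.secondCountableTopology

/-- The map `x ↦ ((n + 1) ^ k * x n)ₙ` to `c₀`. -/
def rapidProj (k : ℕ) : rapidSeq 𝕜 →ₗ[𝕜] C₀(ℕ, 𝕜) where
  toFun f := f.1 k
  map_add' _ _ := rfl
  map_smul' _ _ := rfl

/-- The seminorm `sup_n (n + 1) ^ k * |x n|`. -/
def rapidNorm (k : ℕ) : Seminorm 𝕜 (rapidSeq 𝕜) :=
  (normSeminorm 𝕜 C₀(ℕ, 𝕜)).comp (rapidProj 𝕜 k)

variable {𝕜}

theorem rapidNorm_apply (k : ℕ) (f : rapidSeq 𝕜) : rapidNorm 𝕜 k f = ‖f.1 k‖ := rfl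

theorem withSeminorms_rapidNorm : WithSeminorms (rapidNorm 𝕜) := by
  have h := LinearMap.withSeminorms_induced (𝕜 := 𝕜) (E := rapidSeq 𝕜) (σ₁₂ := RingHom.id 𝕜)
    (withSeminorms_pi (E := fun _ : ℕ => C₀(ℕ, 𝕜)) fun _ => norm_withSeminorms 𝕜 C₀(ℕ, 𝕜))
    (rapidSeq 𝕜).subtype
  -- The product family is indexed by pairs: a factor and the index of its only norm.
  exact h.congr_equiv (Equiv.sigmaUnique ℕ fun _ => Fin 1).symm

theorem norm_natCast_add_one (n : ℕ) : ‖(n : 𝕜) + 1‖ = n + 1 := by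
  exact_mod_cast RCLike.norm_natCast (K := 𝕜) (n + 1)

theorem monotone_rapidNorm : Monotone (rapidNorm 𝕜) := fun k l hkl f => by
  rw [rapidNorm_apply, rapidNorm_apply]
  refine c0_norm_le (norm_nonneg _) fun n => le_trans ?_ (c0_norm_apply_le _ n)
  rw [f.2 k n, f.2 l n, norm_mul, norm_mul, norm_pow, norm_pow, norm_natCast_add_one]
  gcongr
  linarith [n.cast_nonneg (α := ℝ)]

variable (𝕜) in
/-- The rapidly decreasing sequence given by an element of `rapidSeq`. -/
def rapidCoord : rapidSeq 𝕜 →ₗ[𝕜] (ℕ → 𝕜) where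
  toFun f n := f.1 0 n
  map_add' _ _ := rfl
  map_smul' _ _ := rfl

theorem rapidSeq_apply (f : rapidSeq 𝕜) (k n : ℕ) :
    f.1 k n = ((n : 𝕜) + 1) ^ k * rapidCoord 𝕜 f n := f.2 k n

theorem rapidCoord_injective : Function.Injective (rapidCoord 𝕜) := fun f g h => by
  ext k n
  rw [rapidSeq_apply, rapidSeq_apply, h]

/-- The extension of `rapidNorm` to all sequences. -/
def rapidExt (k : ℕ) (x : ℕ → 𝕜) : ℝ≥0∞ := ⨆ n : ℕ, ‖((n : 𝕜) + 1) ^ k * x n‖ₑ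

theorem rapidExt_rapidCoord (k : ℕ) (f : rapidSeq 𝕜) :
    rapidExt k (rapidCoord 𝕜 f) = ENNReal.ofReal (rapidNorm 𝕜 k f) := by
  rw [rapidNorm_apply, ofReal_norm, c0_enorm_eq_iSup]
  exact iSup_congr fun n => by rw [rapidSeq_apply]

theorem lowerSemicontinuous_rapidExt (k : ℕ) : LowerSemicontinuous (rapidExt (𝕜 := 𝕜) k) :=
  lowerSemicontinuous_iSup fun n => Continuous.lowerSemicontinuous (by fun_prop)

/-- Finiteness of the norm of order `k + 1` forces decay like 1 / (n + 1) of the sequence weighted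
to order `k`, so boundedness at all orders already gives null sequences. -/
theorem mem_range_rapidCoord {x : ℕ → 𝕜} (hx : ∀ k, rapidExt k x ≠ ∞) :
    x ∈ Set.range (rapidCoord 𝕜) := by
  have key : ∀ k, Tendsto (fun n : ℕ => ((n : 𝕜) + 1) ^ k * x n) atTop (𝓝 0) := fun k => by
    refine squeeze_zero_norm (a := fun n : ℕ => (rapidExt (k + 1) x).toReal * (1 / ((n : ℝ) + 1)))
      (fun n => ?_) ?_
    · have h1 : ‖((n : 𝕜) + 1) ^ (k + 1) * x n‖ ≤ (rapidExt (k + 1) x).toReal := by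
        rw [← toReal_enorm]
        exact ENNReal.toReal_mono (hx _)
          (le_iSup (fun n : ℕ => ‖((n : 𝕜) + 1) ^ (k + 1) * x n‖ₑ) n)
      rw [pow_succ', mul_assoc, norm_mul, norm_natCast_add_one] at h1
      rw [mul_one_div, le_div_iff₀ (by positivity)]
      linarith
    · simpa using tendsto_one_div_add_atTop_nhds_zero_nat.const_mul (rapidExt (k + 1) x).toReal
  exact ⟨⟨fun k => nullSeq _ (key k), fun k n => by simp⟩, funext fun n => by simp [rapidCoord]⟩

theorem denseRange_rapidProj (k : ℕ) : DenseRange (rapidProj 𝕜 k) := by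
  refine c0_dense_span_unit.mono ?_
  rw [← LinearMap.coe_range, SetLike.coe_subset_coe, Submodule.span_le]
  rintro _ ⟨m, rfl⟩
  have hne : ((m : 𝕜) + 1) ^ k ≠ 0 := pow_ne_zero _ (Nat.cast_add_one_ne_zero m)
  -- The unit sequence, viewed in `rapidSeq`, has component (m + 1)^k times a unit vector at order
  -- `k`; the scalar cancels this weight.
  refine ⟨(((m : 𝕜) + 1) ^ k)⁻¹ • ⟨fun l => ((m : 𝕜) + 1) ^ l • c0Unit 𝕜 m, fun l n => ?_⟩, ?_⟩
  · exact inv_smul_smul₀ hne _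
  · change ((m : 𝕜) + 1) ^ l • c0Unit 𝕜 m n =
      ((n : 𝕜) + 1) ^ l * (((m : 𝕜) + 1) ^ 0 • c0Unit 𝕜 m n)
    rw [c0Unit_apply]
    split_ifs with h <;> simp [h]

theorem nonempty_localBanachSpace_rapidNorm (k : ℕ) :
    Nonempty (LocalBanachSpace (rapidNorm 𝕜 k) ≃ₗᵢ[𝕜] C₀(ℕ, 𝕜)) :=
  nonempty_localBanachSpace_equiv _ (rapidProj 𝕜 k) (fun _ => rfl)
    (denseRange_rapidProj k)

/-- The extension of `weightedSumNorm` to all sequences. -/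
def rapidWeighted (α : ℝ≥0∞) (r : ℕ → ℝ) (x : ℕ → 𝕜) : ℝ≥0∞ :=
  extLpNorm α fun k => ENNReal.ofReal (r k)⁻¹ * rapidExt k x

theorem rapidWeighted_rapidCoord (α : ℝ≥0∞) {r : ℕ → ℝ} (hr : ∀ k, 0 < r k) (f : rapidSeq 𝕜) :
    rapidWeighted α r (rapidCoord 𝕜 f) = weightedSumNorm (rapidNorm 𝕜) α r f := by
  unfold rapidWeighted weightedSumNorm
  congr 1
  ext k
  rw [rapidExt_rapidCoord, ENNReal.ofReal_mul (inv_pos.2 (hr k)).le]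

theorem lowerSemicontinuous_rapidWeighted (α : ℝ≥0∞) (r : ℕ → ℝ) :
    LowerSemicontinuous (rapidWeighted (𝕜 := 𝕜) α r) :=
  lowerSemicontinuous_extLpNorm α fun k =>
    (ENNReal.continuous_const_mul ENNReal.ofReal_ne_top).comp_lowerSemicontinuous
      (lowerSemicontinuous_rapidExt k) fun a b h => by dsimp only; gcongr

theorem rapidExt_le_rapidWeighted {α : ℝ≥0∞} (hα : 1 ≤ α) {r : ℕ → ℝ} (hr : ∀ k, 0 < r k)
    (x : ℕ → 𝕜) (k : ℕ) : rapidExt k x ≤ ENNReal.ofReal (r k) * rapidWeighted α r x := by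
  have h := le_extLpNorm hα (fun k => ENNReal.ofReal (r k)⁻¹ * rapidExt k x) k
  calc rapidExt k x = ENNReal.ofReal (r k) * (ENNReal.ofReal (r k)⁻¹ * rapidExt k x) := by
        rw [← mul_assoc, ← ENNReal.ofReal_mul (hr k).le, mul_inv_cancel₀ (hr k).ne',
          ENNReal.ofReal_one, one_mul]
    _ ≤ _ := by gcongr; exact h

/-- The term of order 0 bounds every coordinate, so Tychonoff's theorem applies; lower
semicontinuity makes the ball closed. -/
theorem isCompact_rapidWeighted_le {α : ℝ≥0∞} (hα : 1 ≤ α) {r : ℕ → ℝ} (hr : ∀ k, 0 < r k)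
    {L : ℝ≥0∞} (hL : L ≠ ∞) : IsCompact {x : ℕ → 𝕜 | rapidWeighted α r x ≤ L} := by
  refine (isCompact_univ_pi fun _ : ℕ =>
    isCompact_closedBall (0 : 𝕜) (ENNReal.ofReal (r 0) * L).toReal).of_isClosed_subset
    ((lowerSemicontinuous_rapidWeighted α r).isClosed_preimage L) fun x hx n _ => ?_
  rw [mem_closedBall_zero_iff, ← toReal_enorm]
  refine ENNReal.toReal_mono (ENNReal.mul_ne_top ENNReal.ofReal_ne_top hL) ?_
  have h1 : ‖x n‖ₑ ≤ rapidExt 0 x :=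
    le_iSup_of_le n (by simp)
  refine h1.trans ((rapidExt_le_rapidWeighted hα hr x 0).trans ?_)
  gcongr
  exact hx

/-- Passing to all scalar sequences, where balls are compact, adds no useful decomposition: a
summand with finite first norm already lies in `rapidSeq`. -/
theorem peetreK_rapidWeighted {α β : ℝ≥0∞} (hα : 1 ≤ α) {r s : ℕ → ℝ} (hr : ∀ k, 0 < r k)
    (hs : ∀ k, 0 < s k) (t : ℝ) (f : rapidSeq 𝕜) :
    peetreK (rapidWeighted α r) (rapidWeighted β s) t (rapidCoord 𝕜 f) =
      peetreK (weightedSumNorm (rapidNorm 𝕜) α r) (weightedSumNorm (rapidNorm 𝕜) β s) t f := by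
  refine le_antisymm (le_iInf fun g => ?_) (le_iInf fun y => ?_)
  · rw [← rapidWeighted_rapidCoord α hr, ← rapidWeighted_rapidCoord β hs, map_sub]
    exact iInf_le _ _
  · by_cases hy : rapidWeighted α r y = ∞
    · simp [hy]
    · obtain ⟨g, rfl⟩ := mem_range_rapidCoord fun k => ne_top_of_le_ne_top
        (ENNReal.mul_ne_top ENNReal.ofReal_ne_top hy) (rapidExt_le_rapidWeighted hα hr y k)
      rw [← map_sub, rapidWeighted_rapidCoord α hr, rapidWeighted_rapidCoord β hs]
      exact iInf_le _ _

theorem realInterpNorm_rapid_le_of_tendsto {α β : ℝ≥0∞} (hα : 1 ≤ α) {r s : ℕ → ℝ}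
    (hr : ∀ k, 0 < r k) (hs : ∀ k, 0 < s k) {θ : ℝ} {q : ℝ≥0∞} (hq : 1 ≤ q)
    {u : ℕ → rapidSeq 𝕜} {x : rapidSeq 𝕜}
    (hu : Tendsto (fun n => rapidCoord 𝕜 (u n)) atTop (𝓝 (rapidCoord 𝕜 x))) {M : ℝ≥0∞}
    (hM : ∀ n, realInterpNorm (weightedSumNorm (rapidNorm 𝕜) α r)
      (weightedSumNorm (rapidNorm 𝕜) β s) θ q (u n) ≤ M) :
    realInterpNorm (weightedSumNorm (rapidNorm 𝕜) α r)
      (weightedSumNorm (rapidNorm 𝕜) β s) θ q x ≤ M := by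
  have h : ∀ f : rapidSeq 𝕜, realInterpNorm (weightedSumNorm (rapidNorm 𝕜) α r)
      (weightedSumNorm (rapidNorm 𝕜) β s) θ q f =
      realInterpNorm (rapidWeighted α r) (rapidWeighted β s) θ q (rapidCoord 𝕜 f) := fun f => by
    simp only [realInterpNorm, peetreK_rapidWeighted hα hr hs]
  rw [h]
  refine realInterpNorm_le_of_tendsto (fun t => lowerSemicontinuous_peetreK
    (lowerSemicontinuous_rapidWeighted α r) (lowerSemicontinuous_rapidWeighted β s)
    (fun L hL => isCompact_rapidWeighted_le hα hr hL) t) hq hu fun n => ?_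
  rw [← h]
  exact hM n

end RapidlyDecreasing

/-! ### Extending operators from c₀ to ℓ_∞ -/

section Extension

variable {𝕜 : Type*} [RCLike 𝕜]

/-- Test `ψ` on a combination of unit vectors with aligned phases. Functionals on c₀ are thus given
by ℓ₁-sequences and can be summed against bounded sequences. -/
theorem sum_norm_apply_unit_le (ψ : C₀(ℕ, 𝕜) →L[𝕜] 𝕜) (s : Finset ℕ) :
    ∑ i ∈ s, ‖ψ (c0Unit 𝕜 i)‖ ≤ ‖ψ‖ := by
  choose ε hε1 hε using exists_norm_le_one_mul_eq_norm (𝕜 := 𝕜)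
  set f : C₀(ℕ, 𝕜) := ∑ i ∈ s, ε (ψ (c0Unit 𝕜 i)) • c0Unit 𝕜 i with hf
  have hf1 : ‖f‖ ≤ 1 := c0_norm_le zero_le_one fun n => by
    simp only [hf, c0_sum_apply, ZeroAtInftyContinuousMap.smul_apply, c0Unit_apply, smul_eq_mul,
      mul_ite, mul_one, mul_zero, Finset.sum_ite_eq]
    split_ifs
    exacts [hε1 _, by simp]
  have hψf : ψ f = ((∑ i ∈ s, ‖ψ (c0Unit 𝕜 i)‖ : ℝ) : 𝕜) := by
    rw [hf, map_sum, RCLike.ofReal_sum]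
    exact Finset.sum_congr rfl fun x _ => by rw [map_smul, smul_eq_mul, hε]
  calc ∑ i ∈ s, ‖ψ (c0Unit 𝕜 i)‖ = ‖ψ f‖ := by
        rw [hψf, RCLike.norm_ofReal, abs_of_nonneg (Finset.sum_nonneg fun _ _ => norm_nonneg _)]
    _ ≤ ‖ψ‖ * ‖f‖ := ψ.le_opNorm f
    _ ≤ ‖ψ‖ := mul_le_of_le_one_right (norm_nonneg ψ) hf1

/-- The truncation of a bounded sequence after `N` terms. -/
def c0Trunc (a : ℕ →ᵇ 𝕜) (N : ℕ) : C₀(ℕ, 𝕜) := ∑ i ∈ Finset.range N, a i • c0Unit 𝕜 i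

theorem c0Trunc_apply (a : ℕ →ᵇ 𝕜) (N n : ℕ) : c0Trunc a N n = if n < N then a n else 0 :=
  c0_sum_unit_apply a N n

theorem norm_c0Trunc_le (a : ℕ →ᵇ 𝕜) (N : ℕ) : ‖c0Trunc a N‖ ≤ ‖a‖ :=
  c0_norm_le (norm_nonneg a) fun n => by
    rw [c0Trunc_apply]
    split_ifs
    exacts [a.norm_coe_le_norm n, by simp]

theorem c0Trunc_unit {n N : ℕ} (h : n < N) : c0Trunc (c0Unit 𝕜 n).toBCF N = c0Unit 𝕜 n := by
  ext m
  rw [c0Trunc_apply, ZeroAtInftyContinuousMap.toBCF_apply]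
  split_ifs with hm
  · rfl
  · rw [c0Unit_apply, if_neg (by omega)]

/-- A bounded operator from `c₀` to the space of rapidly decreasing sequences extends to the
space of bounded sequences. -/
theorem exists_extension_to_bounded (U : C₀(ℕ, 𝕜) →ₗ[𝕜] rapidSeq 𝕜)
    (hU : ∀ k, ∃ M : ℝ, ∀ f, rapidNorm 𝕜 k (U f) ≤ M * ‖f‖) :
    ∃ S : (ℕ →ᵇ 𝕜) →ₗ[𝕜] rapidSeq 𝕜, ∀ a,
      Tendsto (fun N => rapidCoord 𝕜 (U (c0Trunc a N))) atTop (𝓝 (rapidCoord 𝕜 (S a))) := by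
  choose M hM using hU
  let ψ : ℕ → C₀(ℕ, 𝕜) →L[𝕜] 𝕜 := fun j =>
    LinearMap.mkContinuous (LinearMap.proj j ∘ₗ rapidCoord 𝕜 ∘ₗ U) (M 0) fun f =>
      (c0_norm_apply_le ((U f).1 0) j).trans (hM 0 f)
  have hψ : ∀ j f, ψ j f = rapidCoord 𝕜 (U f) j := fun _ _ => rfl
  have hsum : ∀ j, Summable fun i => ‖ψ j (c0Unit 𝕜 i)‖ := fun j =>
    summable_of_sum_le (fun _ => norm_nonneg _) (sum_norm_apply_unit_le (ψ j))
  have hlim : ∀ a : ℕ →ᵇ 𝕜, ∃ x : rapidSeq 𝕜,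
      Tendsto (fun N => rapidCoord 𝕜 (U (c0Trunc a N))) atTop (𝓝 (rapidCoord 𝕜 x)) := fun a => by
    have hcoord : ∀ j, Summable fun i => a i * ψ j (c0Unit 𝕜 i) := fun j =>
      Summable.of_norm_bounded ((hsum j).mul_left ‖a‖) fun i => by
        rw [norm_mul]
        gcongr
        exact a.norm_coe_le_norm i
    have ht : Tendsto (fun N => rapidCoord 𝕜 (U (c0Trunc a N))) atTop
        (𝓝 fun j => ∑' i, a i * ψ j (c0Unit 𝕜 i)) := by
      refine tendsto_pi_nhds.2 fun j => ((hcoord j).hasSum.tendsto_sum_nat).congr fun N => ?_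
      rw [← hψ, c0Trunc, map_sum]
      exact Finset.sum_congr rfl fun i _ => by rw [map_smul, smul_eq_mul]
    -- The images of the truncations are bounded in each seminorm, and lower semicontinuity passes
    -- the bounds to the limit.
    obtain ⟨x, hx⟩ := mem_range_rapidCoord (x := fun j => ∑' i, a i * ψ j (c0Unit 𝕜 i)) fun k => by
      refine ne_top_of_le_ne_top (b := ENNReal.ofReal (|M k| * ‖a‖)) ENNReal.ofReal_ne_top ?_
      refine ((lowerSemicontinuous_rapidExt k).isClosed_preimage _).mem_of_tendsto ht
        (Eventually.of_forall fun N => ?_)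
      rw [Set.mem_preimage, Set.mem_Iic, rapidExt_rapidCoord]
      refine ENNReal.ofReal_le_ofReal ((hM k _).trans ?_)
      gcongr
      exacts [le_abs_self _, norm_c0Trunc_le a N]
    exact ⟨x, hx ▸ ht⟩
  choose S hS using hlim
  refine ⟨{ toFun := S, map_add' := fun a b => ?_, map_smul' := fun c a => ?_ }, hS⟩
  · refine rapidCoord_injective (tendsto_nhds_unique (hS (a + b)) ?_)
    rw [map_add]
    refine ((hS a).add (hS b)).congr fun N => ?_
    rw [← map_add, ← map_add]
    congr 2
    ext n
    simp only [ZeroAtInftyContinuousMap.add_apply, c0Trunc_apply,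
      BoundedContinuousFunction.coe_add, Pi.add_apply]
    split_ifs <;> simp
  · refine rapidCoord_injective (tendsto_nhds_unique (hS (c • a)) ?_)
    rw [RingHom.id_apply, map_smul]
    refine ((hS a).const_smul c).congr fun N => ?_
    rw [← map_smul, ← map_smul]
    congr 2
    ext n
    simp [c0Trunc_apply]

end Extension

/-! ### Bounded discs and the contradiction -/

section Discs

variable {𝕜 : Type*} [RCLike 𝕜]

theorem mem_span_of_egauge_lt_top {E : Type*} [AddCommGroup E] [Module 𝕜 E] {B : Set E} {x : E}
    (h : egauge 𝕜 B x < ∞) : x ∈ Submodule.span 𝕜 B := by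
  obtain ⟨c, hc, -⟩ := egauge_lt_iff.1 h
  obtain ⟨b, hb, rfl⟩ := hc
  exact Submodule.smul_mem _ _ (Submodule.subset_span hb)

theorem seminorm_le_mul_egauge {E : Type*} [AddCommGroup E] [Module 𝕜 E] {B : Set E}
    (p : Seminorm 𝕜 E) {M : ℝ} (hM : ∀ x ∈ B, p x ≤ M) {x : E}
    (hx : egauge 𝕜 B x ≠ ∞) : p x ≤ M * (egauge 𝕜 B x).toReal := by
  have key : ∀ R, (egauge 𝕜 B x).toReal < R → p x ≤ M * R := fun R hR => by
    obtain ⟨c, ⟨b, hb, rfl⟩, hc⟩ := egauge_lt_iff.1 ((ENNReal.lt_ofReal_iff_toReal_lt hx).2 hR)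
    rw [← ofReal_norm, ENNReal.ofReal_lt_ofReal_iff_of_nonneg (norm_nonneg c)] at hc
    calc p (c • b) = ‖c‖ * p b := map_smul_eq_mul p c b
      _ ≤ R * M := mul_le_mul hc.le (hM b hb) (apply_nonneg p b) ((norm_nonneg c).trans hc.le)
      _ = M * R := mul_comm _ _
  refine ge_of_tendsto (x := 𝓝[>] (egauge 𝕜 B x).toReal) (f := fun R => M * R) ?_
    (eventually_nhdsWithin_of_forall key)
  exact (continuous_const_mul M).continuousWithinAt

section DiscSpace

variable {E : Type*} [AddCommGroup E] [Module 𝕜 E] {B : Set E} (hB : IsAbsConvexSet 𝕜 B)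

/-- The inclusion of `E_B` in `E`. -/
def discIncl : DiscSpace hB →ₗ[𝕜] E := (Submodule.span 𝕜 B).subtype

theorem discIncl_injective : Function.Injective (discIncl hB) := Subtype.val_injective

theorem egauge_discIncl_ne_top (x : DiscSpace hB) : egauge 𝕜 B (discIncl hB x) ≠ ∞ :=
  hB.egauge_ne_top (Subtype.property (p := fun x => x ∈ Submodule.span 𝕜 B) x)

theorem norm_discSpace (x : DiscSpace hB) : ‖x‖ = (egauge 𝕜 B (discIncl hB x)).toReal := rfl

theorem exists_discLift {V : Type*} [AddCommGroup V] [Module 𝕜 V] (S : V →ₗ[𝕜] E)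
    (hS : ∀ v, egauge 𝕜 B (S v) < ∞) :
    ∃ S' : V →ₗ[𝕜] DiscSpace hB, ∀ v, discIncl hB (S' v) = S v :=
  ⟨S.codRestrict (Submodule.span 𝕜 B) fun v => mem_span_of_egauge_lt_top (hS v), fun _ => rfl⟩

end DiscSpace

/-- The interpolation norm passes to limits without loss; the two-sided equivalence with p_B costs
the factor C / c. -/
theorem egauge_rapid_le_of_tendsto {B : Set (rapidSeq 𝕜)} (hstar : ConditionStar (rapidNorm 𝕜) B) :
    ∃ A : ℝ, 0 ≤ A ∧ ∀ (u : ℕ → rapidSeq 𝕜) (x : rapidSeq 𝕜) (R : ℝ),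
      Tendsto (fun n => rapidCoord 𝕜 (u n)) atTop (𝓝 (rapidCoord 𝕜 x)) →
      (∀ n, egauge 𝕜 B (u n) ≤ ENNReal.ofReal R) → egauge 𝕜 B x ≤ ENNReal.ofReal (A * R) := by
  obtain ⟨α, β, r, s, hα, -, hr, hs, -, -, -, -, θ, q, c, C, -, -, hq, hc, hC, hN⟩ := hstar
  refine ⟨C * c⁻¹, by positivity, fun u x R hu hR => ?_⟩
  rw [mul_assoc, ENNReal.ofReal_mul hC.le]
  refine (hN _).2.trans ?_
  gcongr
  refine realInterpNorm_rapid_le_of_tendsto hα hr hs hq hu fun n => ?_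
  rw [ENNReal.ofReal_mul (inv_pos.2 hc).le, ENNReal.ofReal_inv_of_pos hc,
    mul_comm (ENNReal.ofReal c)⁻¹, ← div_eq_mul_inv, ENNReal.le_div_iff_mul_le
      (by simp [hc]) (by simp), mul_comm]
  exact (hN (u n)).1.trans (hR n)

theorem isEmpty_discSpace_equiv_c0 {B : Set (rapidSeq 𝕜)} (hB : IsAbsConvexSet 𝕜 B)
    (hbdd : Bornology.IsVonNBounded 𝕜 B) (hstar : ConditionStar (rapidNorm 𝕜) B) :
    IsEmpty (DiscSpace hB ≃L[𝕜] C₀(ℕ, 𝕜)) := by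
  refine ⟨fun T => ?_⟩
  let U : C₀(ℕ, 𝕜) →L[𝕜] DiscSpace hB := T.symm.toContinuousLinearMap
  obtain ⟨D, hD0, hD⟩ := U.bound
  obtain ⟨A, hA0, hA⟩ := egauge_rapid_le_of_tendsto hstar
  obtain ⟨S, hS⟩ := exists_extension_to_bounded (discIncl hB ∘ₗ U.toLinearMap) fun k => by
    obtain ⟨M, hM0, hM⟩ :=
      ((withSeminorms_rapidNorm (𝕜 := 𝕜)).isVonNBounded_iff_seminorm_bounded (s := B)).1 hbdd k
    refine ⟨M * D, fun f => (seminorm_le_mul_egauge _ (fun x hx => (hM x hx).le)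
      (egauge_discIncl_ne_top hB (U f))).trans ?_⟩
    rw [mul_assoc, ← norm_discSpace]
    gcongr
    exact hD f
  have hSle : ∀ a, egauge 𝕜 B (S a) ≤ ENNReal.ofReal (A * (D * ‖a‖)) := fun a =>
    hA _ _ _ (hS a) fun N => by
      change egauge 𝕜 B (discIncl hB (U (c0Trunc a N))) ≤ _
      rw [← ENNReal.ofReal_toReal (egauge_discIncl_ne_top hB (U (c0Trunc a N)))]
      refine ENNReal.ofReal_le_ofReal ((hD _).trans ?_)
      gcongr
      exact norm_c0Trunc_le a N
  obtain ⟨S', hS'⟩ := exists_discLift hB S fun a => (hSle a).trans_lt ENNReal.ofReal_lt_top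
  have hS'norm : ∀ a, ‖S' a‖ ≤ A * D * ‖a‖ := fun a => by
    rw [norm_discSpace, hS', mul_assoc]
    exact ENNReal.toReal_le_of_le_ofReal (by positivity) (hSle a)
  refine not_forall_apply_unit_eq
    (T.toContinuousLinearMap.comp (LinearMap.mkContinuous S' _ hS'norm)) fun n => ?_
  -- Truncations of a unit vector are eventually the vector itself, so `S` extends `U` there.
  have hSn : S (c0Unit 𝕜 n).toBCF = discIncl hB (U (c0Unit 𝕜 n)) := by
    refine rapidCoord_injective (tendsto_nhds_unique (hS _) (tendsto_const_nhds.congr' ?_))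
    filter_upwards [eventually_gt_atTop n] with N hN
    rw [c0Trunc_unit hN]
    rfl
  have hS'n : S' (c0Unit 𝕜 n).toBCF = U (c0Unit 𝕜 n) :=
    discIncl_injective hB ((hS' _).trans hSn)
  rw [ContinuousLinearMap.comp_apply, LinearMap.mkContinuous_apply, hS'n]
  exact T.apply_symm_apply _

end Discs

end

/-- Closedness, the remaining part of the notion of a Banach disc, is not required of `B`. -/
theorem proposition4p6 (𝕜 : Type u) [RCLike 𝕜] :
    ∃ (E : Type u) (_ : AddCommGroup E) (_ : Module 𝕜 E) (_ : UniformSpace E)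
      (p : ℕ → Seminorm 𝕜 E),
      -- `E` is a separable Fréchet space with the increasing fundamental seminorms `p k`
      IsUniformAddGroup E ∧ T2Space E ∧ CompleteSpace E ∧ TopologicalSpace.SeparableSpace E ∧
      WithSeminorms p ∧ Monotone p ∧
      -- all local Banach spaces are isometric to `c₀`
      (∀ k, Nonempty (LocalBanachSpace (p k) ≃ₗᵢ[𝕜] C₀(ℕ, 𝕜))) ∧
      -- no bounded disc satisfying `(*)` generates a space isomorphic to `c₀`
      ∀ (B : Set E) (hB : IsAbsConvexSet 𝕜 B), Bornology.IsVonNBounded 𝕜 B →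
        ConditionStar p B → IsEmpty (DiscSpace hB ≃L[𝕜] C₀(ℕ, 𝕜)) :=
  ⟨rapidSeq 𝕜, inferInstance, inferInstance, inferInstance, rapidNorm 𝕜,
    (rapidSeq 𝕜).toAddSubgroup.isUniformAddGroup, inferInstance,
    (isClosed_rapidSeq 𝕜).completeSpace_coe,
    inferInstance, withSeminorms_rapidNorm,
    monotone_rapidNorm, nonempty_localBanachSpace_rapidNorm,
    fun _ hB => isEmpty_discSpace_equiv_c0 hB⟩
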